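/- Let $G$ be a finite subgroup of $\mathrm{SU}_2$, let $N\trianglelefteq G$ be a normal subgroup, and let $V=\mathbb C^2$ be the natural $G$-module, with character $\chi_V$ (restricted to $N$ when needed). For a $G$-module $\rho$ write $\check\rho=\mathrm{Res}^G_N\rho$, and for an $N$-module $\phi$ write $\hat\phi=\mathrm{Ind}_N^G\phi$. All modules are complex, and spans and linear combinations of modules are formed in the complexified Grothendieck groups, i.e. in terms of characters. Choose irreducible $G$-modules $(\rho_i)_{i\in\check I}$, $\check I$ finite, such that $(\check\rho_i)_{i\in \check I}$ is a basis of the span of all restrictions to $N$ of irreducible $G$-modules, with a node $0\in\check I$ for which $\check\rho_0$ is the one-dimensional trivial $N$-module. Choose irreducible $N$-modules $(\phi_j)_{j\in\hat I}$, $\hat I$ finite, such that $(\hat\phi_j)_{j\in\hat I}$ is a basis of the span of all $G$-modules induced from irreducible $N$-modules, with a node $0\in\hat I$ for which $\phi_0$ is the one-dimensional trivial $N$-module. Then there are unique matrices $\tilde A=(a_{ij})_{i,j\in\check I}$ and $\tilde B=(b_{ij})_{i,j\in\hat I}$ (the adjacency matrices of the two representation graphs) with $$\check V\otimes\check\rho_j=\sum_{i\in\check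 I}a_{ij}\,\check\rho_i,\qquad V\otimes\hat\phi_j=\sum_{i\in\hat I}b_{ij}\,\hat\phi_i .$$ Let $A$ and $B$ be obtained from $\tilde A$ and $\tilde B$ by deleting the row and the column of the special node $0$. Let $$\check m^0(t)=\sum_{k\ge0}\dim\mathrm{Hom}_N(\check\rho_0,V^{\otimes k})\,t^k,\qquad \hat m^0(t)=\sum_{k\ge0}\dim\mathrm{Hom}_G(\hat\phi_0,V^{\otimes k})\,t^k$$ be the Poincaré series of the multiplicities of $\check\rho_0$ and $\hat\phi_0$ in the tensor algebra $T(V)=\bigoplus_{k\ge0}V^{\otimes k}$. Let $\Upsilon$ be a set of representatives of the conjugacy classes of $G$ and put $\Upsilon(N)=\Upsilon\cap N$. Theorem. The series $\check m^0(t)$ is the Poincaré series $\sum_{k\ge0}\dim (V^{\otimes k})^N t^k$ of $T(V)^N$, and, as formal power series in $t$, $$\check m^0(t)=\hat m^0(t)=\frac{\det(I-tA^T)}{\det(I-t\tilde A^T)}=\frac{\det(I-tB^T)}{\det(I-t\tilde B^T)}=\frac{\det(I-tA^T)}{\prod_{g\in\Upsilon(N)}(1-\chi_V(g)t)}=\frac{\det(I-tB^T)}{\prod_{g\in\Upsilon(N)}(1-\chi_V(g)t)}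 .$$ -/

import Mathlib

open scoped TensorProduct PowerSeries

noncomputable section

namespace McKaySlodowy

/-- The compact group `SU₂` of unitary complex `2 × 2` matrices of determinant one. -/
abbrev SU2 := Matrix.specialUnitaryGroup (Fin 2) ℂ

/-- The natural representation of a subgroup `G` of `SU₂` on `V = ℂ²`: a matrix acts on
column vectors by multiplication. -/
def stdRep (G : Subgroup SU2) : Representation ℂ G (Fin 2 → ℂ) where
  toFun g := Matrix.toLin' ((g : SU2) : Matrix (Fin 2) (Fin 2) ℂ)
  map_one' := by simpa using Module.End.one_eq_id.symm
  map_mul' g h := by simp [Matrix.toLin'_mul, Module.End.mul_eq_comp]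

section Reps

variable {H : Type*} [Group H] {U M : Type*} [AddCommGroup U] [Module ℂ U]
  [AddCommGroup M] [Module ℂ M]

/-- The diagonal action of `H` on the `k`-th tensor power `U^{⊗k}`, that is on the
degree `k` component of the tensor algebra `T(U)`. -/
def tensorPow (V : Representation ℂ H U) (k : ℕ) :
    Representation ℂ H (⨂[ℂ] _ : Fin k, U) where
  toFun h := PiTensorProduct.map fun _ => V h
  map_one' := by
    simp only [map_one]
    exact PiTensorProduct.map_one
  map_mul' g h := by
    simp only [map_mul]
    exact PiTensorProduct.map_mul _ _

/-- The restriction to a subgroup `N` of a representation of `H`. -/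
abbrev res (N : Subgroup H) (V : Representation ℂ H U) : Representation ℂ N U :=
  V.comp N.subtype

/-- The one-dimensional trivial module. -/
def IsTrivialLine (V : Representation ℂ H U) : Prop :=
  V.IsTrivial ∧ Module.finrank ℂ U = 1

/-- The Poincaré series `∑ₖ dim Hom_H(S, V^{⊗k}) tᵏ` of the multiplicities of the module `S`
in the tensor algebra `T(V)`. -/
def poincareSeries (S : Representation ℂ H M) (V : Representation ℂ H U) : ℂ⟦X⟧ :=
  PowerSeries.mk fun k =>
    (Module.finrank ℂ (Representation.IntertwiningMap S (tensorPow V k)) : ℂ)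

/-- The Poincaré series `∑ₖ dim (V^{⊗k})^H tᵏ` of the algebra `T(V)^H` of invariants. -/
def invariantSeries (V : Representation ℂ H U) : ℂ⟦X⟧ :=
  PowerSeries.mk fun k => (Module.finrank ℂ (tensorPow V k).invariants : ℂ)

end Reps

section Pairs

variable {G : Type*} [Group G] (N : Subgroup G) {I : Type*} {W : I → Type*}
  [∀ i, AddCommGroup (W i)] [∀ i, Module ℂ (W i)]

/-- `ρ` is a family of irreducible `G`-modules whose restrictions to `N` form a basis of the
span of all restrictions to `N` of irreducible `G`-modules. Modules are identified with their
characters, so that spans are taken in the space of complex functions on `N`. -/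
structure IsRestrictionBasis (ρ : ∀ i, Representation ℂ G (W i)) : Prop where
  irreducible : ∀ i, (ρ i).IsIrreducible
  linearIndependent : LinearIndependent ℂ fun i => (res N (ρ i)).character
  spanning : ∀ (d : ℕ) (σ : Representation ℂ G (Fin d → ℂ)), σ.IsIrreducible →
    (res N σ).character ∈ Submodule.span ℂ (Set.range fun i => (res N (ρ i)).character)

/-- `φ` is a family of irreducible `N`-modules whose induced `G`-modules form a basis of the
span of all `G`-modules induced from irreducible `N`-modules. -/
structure IsInductionBasis (φ : ∀ i, Representation ℂ N (W i)) : Prop where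
  irreducible : ∀ i, (φ i).IsIrreducible
  linearIndependent :
    LinearIndependent ℂ fun i => (Representation.ind N.subtype (φ i)).character
  spanning : ∀ (d : ℕ) (σ : Representation ℂ N (Fin d → ℂ)), σ.IsIrreducible →
    (Representation.ind N.subtype σ).character ∈
      Submodule.span ℂ (Set.range fun i => (Representation.ind N.subtype (φ i)).character)

/-- `A` is the adjacency matrix `(a_{ij})` of the representation graph of the family `S` with
respect to `V`: it collects the coefficients of `V ⊗ S_j = ∑ᵢ a_{ij} S_i`, an identity between
classes of modules, that is between characters. -/
def IsFusionMatrix {H : Type*} [Group H] [Fintype I] {U : Type*} [AddCommGroup U] [Module ℂ U]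
    (V : Representation ℂ H U) (S : ∀ i, Representation ℂ H (W i)) (A : Matrix I I ℂ) : Prop :=
  ∀ j, (V.tprod (S j)).character = ∑ i, A i j • (S i).character

end Pairs

/-- The matrix obtained from `A` by deleting the row and the column of the node `i₀`. -/
def deleteNode {I : Type*} (A : Matrix I I ℂ) (i₀ : I) :
    Matrix {i : I // i ≠ i₀} {i : I // i ≠ i₀} ℂ :=
  A.submatrix Subtype.val Subtype.val

/-- `det(I - t Aᵀ)`, as a power series in `t`. -/
def detOneSub {I : Type*} [Fintype I] [DecidableEq I] (A : Matrix I I ℂ) : ℂ⟦X⟧ :=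
  Matrix.det (1 - (PowerSeries.X : ℂ⟦X⟧) • Matrix.transpose (A.map fun a => PowerSeries.C a))

/-- `Υ` contains exactly one element of each conjugacy class of `G`. -/
def IsConjRepresentatives {G : Type*} [Group G] (Υ : Finset G) : Prop :=
  ∀ c : ConjClasses G, ∃! g : G, g ∈ Υ ∧ ConjClasses.mk g = c

open Classical in
/-- `∏ (1 - χ(g) t)` over the elements `g` of `Υ ∩ N`. -/
def charProd {G : Type*} [Group G] (N : Subgroup G) (Υ : Finset G) (χ : G → ℂ) : ℂ⟦X⟧ :=
  ∏ g ∈ Υ with g ∈ N, (1 - PowerSeries.C (χ g) * PowerSeries.X)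

end McKaySlodowy

end

/-! Let `C` be the space of class functions on `G` supported in the normal subgroup `N`. The
restricted characters, extended by zero, form a basis of `C` (`span_extendZero_res_character`), and
so do the induced characters (`span_ind_character`). Both adjacency matrices therefore represent
multiplication by the character of `V` on `C`, which is diagonal in the indicator functions of the
classes in `N`; this gives the common denominator (`detOneSub_eq_charProd`).

For the numerators, characters of `SU2` are invariant under inversion, so `Hom(S_j, V^{⊗(k+1)})` has
the dimension of `Hom(V ⊗ S_j, V^{⊗k})`. The multiplicity series thus satisfy `M_j = δ_{j,0} + t ∑ᵢ
a_{ij} M_i`, and Cramer's rule gives `M_0 det(I - tÃᵀ) = det(I - tAᵀ)`; likewise for `B`. Frobenius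
reciprocity identifies the two series `M_0`, so the numerators agree as well. -/

namespace McKaySlodowy

open Representation

/-! ### Irreducible modules of finite groups -/

section Irreducible

variable {H : Type*} [Group H] {U M : Type*} [AddCommGroup U] [Module ℂ U]
  [AddCommGroup M] [Module ℂ M]

lemma isIrreducible_iff (σ : Representation ℂ H U) :
    σ.IsIrreducible ↔ Nontrivial U ∧
      ∀ p : Submodule ℂ U, (∀ g, ∀ v ∈ p, σ g v ∈ p) → p = ⊥ ∨ p = ⊤ := by
  constructor
  · intro h
    refine ⟨?_, fun p hp => ?_⟩
    · by_contra hU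
      rw [not_nontrivial_iff_subsingleton] at hU
      have : (⊥ : Subrepresentation σ) = ⊤ :=
        Subrepresentation.toSubmodule_injective (Subsingleton.elim _ _)
      exact bot_ne_top this
    · rcases eq_bot_or_eq_top (⟨p, fun g v hv => hp g v hv⟩ : Subrepresentation σ) with h | h
      · exact Or.inl (congrArg Subrepresentation.toSubmodule h)
      · exact Or.inr (congrArg Subrepresentation.toSubmodule h)
  · rintro ⟨hU, hp⟩
    refine @IsSimpleOrder.mk _ _ _ ⟨⊥, ⊤, fun h => ?_⟩ fun p => ?_
    · exact bot_ne_top (congrArg Subrepresentation.toSubmodule h : (⊥ : Submodule ℂ U) = ⊤)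
    · rcases hp p.toSubmodule fun g v hv => p.apply_mem_toSubmodule g hv with h | h
      · exact Or.inl (Subrepresentation.toSubmodule_injective h)
      · exact Or.inr (Subrepresentation.toSubmodule_injective h)

/-- The orbit of a nonzero vector is finite and spans an invariant subspace. -/
lemma finiteDimensional_of_isIrreducible [Finite H] (σ : Representation ℂ H U)
    (hσ : σ.IsIrreducible) : FiniteDimensional ℂ U := by
  obtain ⟨hU, hp⟩ := (isIrreducible_iff σ).1 hσ
  obtain ⟨v, hv⟩ := exists_ne (0 : U)
  have hfin : (Set.range fun g => σ g v).Finite := Set.finite_range _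
  rcases hp (Submodule.span ℂ (Set.range fun g => σ g v)) (fun g w hw => by
    induction hw using Submodule.span_induction with
    | mem x hx =>
      obtain ⟨h, rfl⟩ := hx
      exact Submodule.subset_span ⟨g * h, by simp⟩
    | zero => simp
    | add x y _ _ hx hy => rw [map_add]; exact add_mem hx hy
    | smul a x _ hx => rw [map_smul]; exact Submodule.smul_mem _ _ hx) with h | h
  · exact absurd ((Submodule.span_eq_bot.1 h) v ⟨1, by simp⟩) hv
  · exact Module.finite_def.2 (h ▸ Submodule.fg_span hfin)

/-- The spanning hypotheses only quantify over modules on `Fin d → ℂ`; this brings other modules to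
that form. -/
lemma exists_fin_equiv [FiniteDimensional ℂ U] (σ : Representation ℂ H U) :
    ∃ σ' : Representation ℂ H (Fin (Module.finrank ℂ U) → ℂ), Nonempty (σ.Equiv σ') := by
  let e : U ≃ₗ[ℂ] (Fin (Module.finrank ℂ U) → ℂ) := (Module.finBasis ℂ U).equivFun
  refine ⟨(e.conjRingEquiv : Module.End ℂ U →* _).comp σ, ⟨Representation.Equiv.mk e fun g => ?_⟩⟩
  refine LinearMap.ext fun v => ?_
  simp [LinearEquiv.conjRingEquiv]

lemma exists_linearEquiv_of_equiv {σ : Representation ℂ H U} {τ : Representation ℂ H M}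
    (e : σ.Equiv τ) : ∃ E : U ≃ₗ[ℂ] M, ∀ g v, E (σ g v) = τ g (E v) :=
  ⟨e.toLinearEquiv, fun g v => LinearMap.congr_fun (e.isIntertwining' g) v⟩

lemma isIrreducible_of_equiv {σ : Representation ℂ H U} {τ : Representation ℂ H M}
    (e : σ.Equiv τ) (hσ : σ.IsIrreducible) : τ.IsIrreducible := by
  obtain ⟨hU, hp⟩ := (isIrreducible_iff σ).1 hσ
  obtain ⟨E, he⟩ := exists_linearEquiv_of_equiv e
  refine (isIrreducible_iff τ).2 ⟨E.symm.toEquiv.nontrivial, fun p hq => ?_⟩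
  rcases hp (p.comap E.toLinearMap) (fun g v hv => by
    rw [Submodule.mem_comap] at hv ⊢
    exact (he g v).symm ▸ hq g _ hv) with h | h
  · left
    rw [eq_bot_iff]
    intro x hx
    have : E.symm x ∈ p.comap E.toLinearMap := by simpa using hx
    rw [h] at this
    simpa using this
  · right
    rw [eq_top_iff]
    intro x _
    have : E.symm x ∈ p.comap E.toLinearMap := by rw [h]; trivial
    simpa using this

end Irreducible

/-! ### Irreducible characters span the class functions -/

section Completeness

variable {H : Type*} [Group H] [Fintype H]

/-- Induction on the dimension. On an irreducible module the operator is a scalar by Schur's lemma,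
and its trace vanishes by `h0`. A reducible module splits into two smaller ones by Maschke's
theorem. -/
lemma sum_smul_apply_eq_zero {f : H → ℂ} (hf : ∀ x g, f (x * g * x⁻¹) = f g)
    (h0 : ∀ (d : ℕ) (σ : Representation ℂ H (Fin d → ℂ)), σ.IsIrreducible →
      ∑ g, f g * σ.character g = 0) (n : ℕ) :
    ∀ (U : Type) [AddCommGroup U] [Module ℂ U] [FiniteDimensional ℂ U]
      (σ : Representation ℂ H U), Module.finrank ℂ U = n → ∑ g, f g • σ g = 0 := by
  induction n using Nat.strong_induction_on with
  | _ n ih =>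
  intro U _ _ _ σ hn
  by_cases hσ : σ.IsIrreducible
  · have hcomm : ∀ x, (∑ g, f g • σ g) ∘ₗ σ x = σ x ∘ₗ (∑ g, f g • σ g) := by
      intro x
      simp only [← Module.End.mul_eq_comp, Finset.sum_mul, Finset.mul_sum, smul_mul_assoc,
        mul_smul_comm, ← map_mul]
      refine Fintype.sum_equiv (MulAut.conj x⁻¹).toEquiv _ _ fun g => ?_
      have hx : f (x⁻¹ * g * x) = f g := by simpa using hf x⁻¹ g
      simp [← mul_assoc, hx]
    let T : IntertwiningMap σ σ := ⟨_, hcomm⟩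
    obtain ⟨c, hc⟩ := (IsIrreducible.algebraMap_intertwiningMap_bijective_of_isAlgClosed
      (ρ := σ)).2 T
    have hT : (∑ g, f g • σ g) = c • LinearMap.id := by
      ext v
      have := congrArg (fun S : IntertwiningMap σ σ => S v) hc
      rw [LinearMap.smul_apply, LinearMap.id_apply]
      exact this.symm
    obtain ⟨σ', ⟨e⟩⟩ := exists_fin_equiv σ
    have h1 := h0 _ σ' (isIrreducible_of_equiv e hσ)
    rw [← char_iso e] at h1
    have h2 := congrArg (LinearMap.trace ℂ U) hT
    rw [map_sum] at h2
    simp only [map_smul, smul_eq_mul] at h2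
    change ∑ g, f g * σ.character g = _ at h2
    rw [h1, LinearMap.trace_id] at h2
    have : Nontrivial U := ((isIrreducible_iff σ).1 hσ).1
    have hd : (Module.finrank ℂ U : ℂ) ≠ 0 := by
      exact_mod_cast (Module.finrank_pos (R := ℂ) (M := U)).ne'
    have hc0 : c = 0 := by simpa [hd] using h2.symm
    rw [hT, hc0, zero_smul]
  · rcases subsingleton_or_nontrivial U with hU | hU
    · ext v; exact Subsingleton.elim _ _
    rw [isIrreducible_iff] at hσ
    push Not at hσ
    obtain ⟨p, hp, hpb, hpt⟩ := hσ hU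
    obtain ⟨q, hq⟩ := exists_isCompl (⟨p, fun g v hv => hp g v hv⟩ : Subrepresentation σ)
    have hsup : p ⊔ q.toSubmodule = ⊤ :=
      congrArg Subrepresentation.toSubmodule hq.sup_eq_top
    have hinf : p ⊓ q.toSubmodule = ⊥ :=
      congrArg Subrepresentation.toSubmodule hq.inf_eq_bot
    have hqt : q.toSubmodule ≠ ⊤ := by
      intro h; rw [h, inf_top_eq] at hinf; exact hpb hinf
    have key : ∀ r : Subrepresentation σ, r.toSubmodule ≠ ⊤ → ∀ v ∈ r.toSubmodule,
        (∑ g, f g • σ g) v = 0 := by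
      intro r hr v hv
      have := ih _ (hn ▸ Submodule.finrank_lt hr) r.toSubmodule
        r.toRepresentation rfl
      have := congrArg Subtype.val (LinearMap.congr_fun this ⟨v, hv⟩)
      simpa [Subrepresentation.toRepresentation] using! this
    ext v
    obtain ⟨a, ha, b, hb, rfl⟩ := Submodule.mem_sup.1 (hsup ▸ Submodule.mem_top : v ∈ _)
    rw [map_add, key ⟨p, fun g v hv => hp g v hv⟩ hpt a ha, key q hqt b hb]
    simp

/-- A class function orthogonal to all irreducible characters vanishes. -/
lemma eq_zero_of_forall_sum_mul_character {f : H → ℂ} (hf : ∀ x g, f (x * g * x⁻¹) = f g)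
    (h0 : ∀ (d : ℕ) (σ : Representation ℂ H (Fin d → ℂ)), σ.IsIrreducible →
      ∑ g, f g * σ.character g = 0) : f = 0 := by
  -- The induction above concerns modules in `Type`, whereas `H` may live in another universe; hence
  -- the passage to coordinates.
  obtain ⟨σ, ⟨e⟩⟩ := exists_fin_equiv (Representation.leftRegular ℂ H)
  have h := sum_smul_apply_eq_zero hf h0 _ _ σ rfl
  obtain ⟨E, he⟩ := exists_linearEquiv_of_equiv e
  -- Applied to the unit of the group algebra, the operator returns `f` itself as a list of
  -- coefficients.
  have h1 : ∑ g, f g • Representation.leftRegular ℂ H g (MonoidAlgebra.single 1 1) = 0 := by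
    apply E.injective
    have := LinearMap.congr_fun h (E (MonoidAlgebra.single 1 1))
    rw [map_sum, map_zero]
    simp only [map_smul, he]
    simpa only [LinearMap.sum_apply, LinearMap.smul_apply, LinearMap.zero_apply] using this
  ext x
  classical
  have h2 := congrArg (fun z => z.coeff x) h1
  simpa [MonoidAlgebra.coeff_sum, Finsupp.finsetSum_apply, Finsupp.single_apply] using h2

/-- Otherwise a functional `L` kills all irreducible characters but not `f`. Averaging `L` over
conjugation gives a class function `l` whose pairing with any class function `h` is `|H| L h`. It is
orthogonal to the irreducible characters, hence zero, contradicting `L f ≠ 0`. -/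
lemma class_mem_span_irreducible_characters {f : H → ℂ} (hf : ∀ x g, f (x * g * x⁻¹) = f g) :
    f ∈ Submodule.span ℂ {χ : H → ℂ | ∃ (d : ℕ) (σ : Representation ℂ H (Fin d → ℂ)),
      σ.IsIrreducible ∧ χ = σ.character} := by
  by_contra hmem
  obtain ⟨L, hLf, hL⟩ := Submodule.exists_le_ker_of_notMem hmem
  classical
  let l : H → ℂ := fun g => ∑ x, L (Pi.single (x * g * x⁻¹) 1)
  have hpair : ∀ h : H → ℂ, (∀ x g, h (x * g * x⁻¹) = h g) →
      ∑ g, l g * h g = Fintype.card H * L h := by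
    intro h hh
    have hLh : ∀ h : H → ℂ, L h = ∑ g, h g * L (Pi.single g 1) := by
      intro h
      conv_lhs => rw [pi_eq_sum_univ h]
      rw [map_sum]
      refine Finset.sum_congr rfl fun g _ => ?_
      rw [map_smul, smul_eq_mul]
      congr 2
      ext y
      simp [Pi.single_apply, eq_comm]
    simp only [l, Finset.sum_mul]
    rw [Finset.sum_comm]
    have : ∀ x : H, ∑ g, L (Pi.single (x * g * x⁻¹) 1) * h g = L h := by
      intro x
      rw [hLh h]
      refine Fintype.sum_equiv (MulAut.conj x).toEquiv _ _ fun g => ?_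
      simp [MulAut.conj_apply, hh, mul_comm]
    simp [this]
  have hl : l = 0 := by
    refine eq_zero_of_forall_sum_mul_character (fun x g => ?_) fun d σ hσ => ?_
    · refine Fintype.sum_equiv (Equiv.mulRight x) _ _ fun y => ?_
      simp [mul_assoc]
    · rw [hpair _ fun x g => σ.char_conj g x]
      have : L σ.character = 0 := hL (Submodule.subset_span ⟨d, σ, hσ, rfl⟩)
      rw [this, mul_zero]
  have := hpair f hf
  rw [hl] at this
  simp [hLf] at this

end Completeness

/-! ### Determinants over power series -/

section Determinants

variable {I : Type*} [Fintype I] [DecidableEq I]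

lemma constantCoeff_detOneSub (A : Matrix I I ℂ) :
    PowerSeries.constantCoeff (detOneSub A) = 1 := by
  unfold detOneSub
  rw [RingHom.map_det]
  have : (PowerSeries.constantCoeff (R := ℂ)).mapMatrix
      (1 - (PowerSeries.X : ℂ⟦X⟧) • Matrix.transpose (A.map fun a => PowerSeries.C a)) = 1 := by
    rw [map_sub, map_one]
    ext i j
    simp
  rw [this, Matrix.det_one]

/-- Cramer's rule for the system `Mⱼ = δ_{j,i₀} + t ∑ᵢ a_{ij} Mᵢ`. -/
lemma mul_detOneSub_eq (A : Matrix I I ℂ) (M : I → ℂ⟦X⟧) (i₀ : I)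
    (h : ∀ j, M j = (if j = i₀ then 1 else 0) +
      PowerSeries.X * ∑ i, PowerSeries.C (A i j) * M i) :
    M i₀ * detOneSub A = detOneSub (deleteNode A i₀) := by
  set D : Matrix I I ℂ⟦X⟧ :=
    1 - (PowerSeries.X : ℂ⟦X⟧) • Matrix.transpose (A.map fun a => PowerSeries.C a) with hD
  have h1 : D.mulVec M = Pi.single i₀ 1 := by
    ext1 j
    rw [hD, Matrix.sub_mulVec, Matrix.one_mulVec, Matrix.smul_mulVec, Pi.sub_apply, Pi.smul_apply,
      smul_eq_mul, Pi.single_apply]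
    conv_lhs => rw [h j]
    simp [Matrix.mulVec, dotProduct]
  have h2 : D.det * M i₀ = D.adjugate i₀ i₀ := by
    have := congrArg (fun v => (D.adjugate.mulVec v) i₀) h1
    simpa [Matrix.mulVec_mulVec, Matrix.adjugate_mul, Matrix.smul_mulVec] using this
  have h3 : D.adjugate i₀ i₀ = detOneSub (deleteNode A i₀) := by
    -- Replacing row `i₀` by a unit vector makes the matrix block triangular, with a block `1` at
    -- `i₀` and the matrix of the deleted graph as the other block.
    rw [Matrix.adjugate_apply, Matrix.twoBlockTriangular_det' _ (fun i => i = i₀)]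
    · have hdet : ∀ {inst₁ : DecidableEq {i // i = i₀}} {inst₂ : Fintype {i // i = i₀}}
          (B : Matrix {i // i = i₀} {i // i = i₀} ℂ⟦X⟧), @Matrix.det _ inst₁ inst₂ _ _ B =
          B ⟨i₀, rfl⟩ ⟨i₀, rfl⟩ := by
        intro _ _ B
        have : Subsingleton {i // i = i₀} := ⟨fun a b => Subtype.ext (a.2.trans b.2.symm)⟩
        exact Matrix.det_eq_elem_of_subsingleton B _
      refine (congrArg₂ (· * ·) (hdet _) rfl).trans ?_
      have h1 : Matrix.toSquareBlockProp (D.updateRow i₀ (Pi.single i₀ 1)) (fun i => i = i₀)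
          ⟨i₀, rfl⟩ ⟨i₀, rfl⟩ = 1 := by
        simp [Matrix.toSquareBlockProp]
      rw [h1, one_mul]
      unfold detOneSub deleteNode
      congr 1
      ext1 i j
      have hi := i.2
      simp [Matrix.toSquareBlockProp, hD, Matrix.updateRow_apply, hi, Matrix.one_apply,
        Subtype.ext_iff]
    · rintro i rfl j hj
      simp [hj]
  rw [mul_comm, ← h3, ← h2]
  rfl

lemma linearIndependent_matrix_det_ne_zero (M : Matrix I I ℂ)
    (hM : LinearIndependent ℂ fun i => M i) : M.det ≠ 0 := by
  have := Matrix.linearIndependent_rows_iff_isUnit.1 hM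
  exact ((Matrix.isUnit_iff_isUnit_det M).1 this).ne_zero

/-- The determinant of `1 - t Aᵀ` for the matrix `A` of multiplication by `f` in a basis of the
space of functions on a finite set. -/
lemma detOneSub_eq_prod {X : Type*} [Fintype X] (b : I → X → ℂ)
    (hb : LinearIndependent ℂ b) (hspan : Submodule.span ℂ (Set.range b) = ⊤) (f : X → ℂ)
    (A : Matrix I I ℂ) (hA : ∀ j x, f x * b j x = ∑ i, A i j * b i x) :
    detOneSub A = ∏ x, (1 - PowerSeries.C (f x) * PowerSeries.X) := by
  have hcard : Fintype.card I = Fintype.card X := by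
    rw [← Module.finrank_eq_card_basis (Module.Basis.mk hb hspan.ge), Module.finrank_pi]
  let e : I ≃ X := Fintype.equivOfCardEq hcard
  let M : Matrix I I ℂ := Matrix.of fun j i => b j (e i)
  have hM : M.det ≠ 0 := by
    refine linearIndependent_matrix_det_ne_zero M ?_
    have := hb.map' (LinearEquiv.funCongrLeft ℂ ℂ e).toLinearMap (LinearEquiv.ker _)
    exact this
  have hC : (M.map fun a => (PowerSeries.C a : ℂ⟦X⟧)).det = PowerSeries.C M.det :=
    (RingHom.map_det _ _).symm
  -- The matrix `M` of values of the basis diagonalizes `Aᵀ`; its determinant is a nonzero constant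
  -- and cancels.
  have hmul : (1 - (PowerSeries.X : ℂ⟦X⟧) • Matrix.transpose (A.map fun a => PowerSeries.C a)) *
      (M.map fun a => PowerSeries.C a) = (M.map fun a => (PowerSeries.C a : ℂ⟦X⟧)) *
        Matrix.diagonal fun i => 1 - PowerSeries.C (f (e i)) * PowerSeries.X := by
    ext1 j i
    rw [Matrix.mul_diagonal, sub_mul, one_mul, Matrix.smul_mul, Matrix.sub_apply,
      Matrix.smul_apply, Matrix.mul_apply]
    simp only [Matrix.transpose_apply, Matrix.map_apply, ← map_mul, ← map_sum]
    have := hA j (e i)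
    simp only [M, Matrix.of_apply, ← this, smul_eq_mul, map_mul]
    ring
  have hdet := congrArg Matrix.det hmul
  rw [Matrix.det_mul, Matrix.det_mul, Matrix.det_diagonal, hC, mul_comm] at hdet
  have hne : (PowerSeries.C M.det : ℂ⟦X⟧) ≠ 0 := by
    simpa using hM
  have := mul_left_cancel₀ hne hdet
  rw [← Equiv.prod_comp e]
  exact this

end Determinants

/-! ### Characters of tensor powers -/

section Reps

variable {H : Type*} [Group H] {U M : Type*} [AddCommGroup U] [Module ℂ U]
  [AddCommGroup M] [Module ℂ M]

lemma tensorPow_character [FiniteDimensional ℂ U] (V : Representation ℂ H U) (k : ℕ) :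
    (tensorPow V k).character = V.character ^ k := by
  induction k with
  | zero =>
    ext h
    have : Module.finrank ℂ (⨂[ℂ] _ : Fin 0, U) = 1 := by
      rw [(PiTensorProduct.isEmptyEquiv (R := ℂ) (s := fun _ : Fin 0 => U) (Fin 0)).finrank_eq,
        Module.finrank_self]
    have h1 : tensorPow V 0 h = 1 := by
      refine PiTensorProduct.ext (MultilinearMap.ext fun v => ?_)
      simp only [tensorPow, MonoidHom.coe_mk, OneHom.coe_mk, LinearMap.compMultilinearMap_apply,
        PiTensorProduct.map_tprod, Module.End.one_apply]
      exact congrArg _ (Subsingleton.elim _ _)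
    rw [character, h1, LinearMap.trace_one, this]
    simp
  | succ k ih =>
    let E : ((⨂[ℂ] _ : Fin k, U) ⊗[ℂ] (⨂[ℂ] _ : Fin 1, U)) ≃ₗ[ℂ] (⨂[ℂ] _ : Fin (k + 1), U) :=
      TensorPower.mulEquiv
    let F : ((⨂[ℂ] _ : Fin k, U) ⊗[ℂ] U) ≃ₗ[ℂ] (⨂[ℂ] _ : Fin (k + 1), U) :=
      (TensorProduct.congr (LinearEquiv.refl ℂ _)
        (PiTensorProduct.subsingletonEquiv (0 : Fin 1)).symm).trans E
    have e : ((tensorPow V k).tprod V).Equiv (tensorPow V (k + 1)) := by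
      refine Representation.Equiv.mk F fun h => ?_
      refine TensorProduct.ext (PiTensorProduct.ext (MultilinearMap.ext fun v =>
        LinearMap.ext fun u => ?_))
      simp [F, E, tensorPow, TensorPower.mulEquiv, PiTensorProduct.subsingletonEquiv_symm_apply']
      congr 1
      ext i
      rcases finSumFinEquiv.symm i with _ | _ <;> rfl
    rw [← char_iso e, char_tensor, ih, pow_succ]

end Reps

/-! ### Induced modules and Frobenius reciprocity -/

section Frobenius

variable {G : Type*} [Group G] (N : Subgroup G) {U M : Type*} [AddCommGroup U] [Module ℂ U]
  [AddCommGroup M] [Module ℂ M]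

instance [Finite G] [FiniteDimensional ℂ U] (φ : Representation ℂ N U) :
    FiniteDimensional ℂ (Representation.IndV N.subtype φ) := by
  have : FiniteDimensional ℂ (MonoidAlgebra ℂ G) :=
    Module.Finite.equiv (MonoidAlgebra.coeffLinearEquiv ℂ).symm
  have h : FiniteDimensional ℂ (MonoidAlgebra ℂ G ⊗[ℂ] U) := inferInstance
  exact Module.Finite.of_surjective (Coinvariants.mk _) (Coinvariants.mk_surjective _)

/-- Frobenius reciprocity. -/
noncomputable def indHomEquiv (φ : Representation ℂ N U) (τ : Representation ℂ G M) :
    IntertwiningMap (Representation.ind N.subtype φ) τ ≃ₗ[ℂ] IntertwiningMap φ (res N τ) where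
  toFun f := ⟨f.toLinearMap ∘ₗ IndV.mk N.subtype φ 1, fun g => by
    ext x
    have := LinearMap.congr_fun (f.isIntertwining' (g : G)) (IndV.mk N.subtype φ 1 x)
    simp_all [← Coinvariants.mk_inv_tmul]⟩
  map_add' _ _ := rfl
  map_smul' _ _ := rfl
  -- In `ind`, the element `g` sends the class of `h ⊗ x` to that of `hg⁻¹ ⊗ x`. So the class of `h
  -- ⊗ x` is the `h⁻¹`-translate of that of `1 ⊗ x`, which forces `τ h⁻¹`.
  invFun f := ⟨Representation.Coinvariants.lift _
    (TensorProduct.lift <| (Finsupp.lift _ _ _ fun h => τ h⁻¹ ∘ₗ f.toLinearMap) ∘ₗ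
      (MonoidAlgebra.coeffLinearEquiv ℂ).toLinearMap)
    fun g ↦ by
      ext h x
      have := LinearMap.congr_fun (f.isIntertwining' g) x
      simp_all, fun g ↦ by ext; simp⟩
  left_inv f := by
    ext h a
    have := LinearMap.congr_fun (f.isIntertwining' h⁻¹) (IndV.mk N.subtype φ 1 a)
    simpa using! this.symm
  right_inv _ := by ext; simp

end Frobenius

/-! ### Multiplicities as averages of characters -/

section Multiplicity

variable {H : Type*} [Group H] [Fintype H] {U M : Type*} [AddCommGroup U] [Module ℂ U]
  [AddCommGroup M] [Module ℂ M] [FiniteDimensional ℂ U] [FiniteDimensional ℂ M]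

lemma card_ne_zero : (Nat.card H : ℂ) ≠ 0 := by
  exact_mod_cast Nat.card_pos.ne'

lemma finrank_intertwiningMap_eq (σ : Representation ℂ H U) (τ : Representation ℂ H M) :
    (Module.finrank ℂ (IntertwiningMap σ τ) : ℂ) =
      (Nat.card H : ℂ)⁻¹ * ∑ g, σ.character g⁻¹ * τ.character g := by
  have : Invertible (Nat.card H : ℂ) := invertibleOfNonzero card_ne_zero
  rw [← card_inv_mul_sum_char_mul_char_eq_finrank]
  simp only [mul_comm]

lemma finrank_invariants_eq (σ : Representation ℂ H U) :
    (Module.finrank ℂ σ.invariants : ℂ) = (Nat.card H : ℂ)⁻¹ * ∑ g, σ.character g⁻¹ := by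
  have : Invertible (Nat.card H : ℂ) := invertibleOfNonzero card_ne_zero
  rw [← card_inv_mul_sum_char_eq_finrank]
  congr 1
  exact Fintype.sum_equiv (Equiv.inv H) _ _ fun g => by simp

end Multiplicity

/-! ### Two bases of the class functions supported in `N` -/

section ClassFunctions

variable {G : Type*} [Group G] (N : Subgroup G)

/-- The class functions on `G` supported in `N`. -/
def classFunctionsOn : Submodule ℂ (G → ℂ) where
  carrier := {f | (∀ x g, f (x * g * x⁻¹) = f g) ∧ ∀ g, g ∉ N → f g = 0}
  zero_mem' := by simp
  add_mem' hf hh := ⟨fun x g => by simp [hf.1, hh.1], fun g hg => by simp [hf.2 g hg, hh.2 g hg]⟩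
  smul_mem' c f hf := ⟨fun x g => by simp [hf.1], fun g hg => by simp [hf.2 g hg]⟩

/-- Extension of functions from `N` to `G` by zero. -/
noncomputable def extendZero : (N → ℂ) →ₗ[ℂ] (G → ℂ) :=
  Function.ExtendByZero.linearMap ℂ (Subtype.val : N → G)

lemma extendZero_coe (ψ : N → ℂ) (n : N) : extendZero N ψ n = ψ n :=
  Subtype.val_injective.extend_apply _ _ n

lemma extendZero_of_notMem (ψ : N → ℂ) {g : G} (hg : g ∉ N) : extendZero N ψ g = 0 :=
  Function.extend_apply' _ _ _ fun ⟨n, hn⟩ => hg (hn ▸ n.2)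

lemma extendZero_injective : Function.Injective (extendZero N) := fun ψ ψ' h => by
  ext n
  rw [← extendZero_coe N ψ, h, extendZero_coe]

lemma extendZero_restrict {f : G → ℂ} (hf : ∀ g, g ∉ N → f g = 0) :
    extendZero N (fun n => f n) = f := by
  ext g
  by_cases hg : g ∈ N
  · exact extendZero_coe N _ ⟨g, hg⟩
  · rw [extendZero_of_notMem N _ hg, hf g hg]

lemma sum_extendZero_mul [Fintype G] [Fintype N] (ψ : N → ℂ) (h : G → ℂ) :
    ∑ g, extendZero N ψ g * h g = ∑ n, ψ n * h n :=
  (Fintype.sum_of_injective _ Subtype.val_injective _ _ (fun g hg => by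
    rw [extendZero_of_notMem N ψ (by simpa using hg), zero_mul])
    fun n => by rw [extendZero_coe]).symm

lemma extendZero_res_character_mem [N.Normal] {U : Type*} [AddCommGroup U] [Module ℂ U]
    (σ : Representation ℂ G U) :
    extendZero N (res N σ).character ∈ classFunctionsOn N := by
  refine ⟨fun x g => ?_, fun g hg => extendZero_of_notMem N _ hg⟩
  by_cases hg : g ∈ N
  · rw [extendZero_coe N _ ⟨_, Subgroup.Normal.conj_mem ‹_› g hg x⟩, extendZero_coe N _ ⟨g, hg⟩]
    exact σ.char_conj g x
  · rw [extendZero_of_notMem N _ hg, extendZero_of_notMem]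
    rwa [Subgroup.Normal.mem_comm_iff ‹_›, inv_mul_cancel_left]

/-- The function on `G` induced from a function on `N`. -/
noncomputable def inducedFunction [Fintype G] : (N → ℂ) →ₗ[ℂ] (G → ℂ) :=
  (Nat.card N : ℂ)⁻¹ • ∑ x : G,
    (LinearMap.funLeft ℂ ℂ fun g => x * g * x⁻¹) ∘ₗ extendZero N

lemma inducedFunction_apply [Fintype G] (ψ : N → ℂ) (g : G) :
    inducedFunction N ψ g = (Nat.card N : ℂ)⁻¹ * ∑ x : G, extendZero N ψ (x * g * x⁻¹) := by
  simp [inducedFunction, LinearMap.sum_apply, Finset.sum_apply, LinearMap.funLeft_apply]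

lemma inducedFunction_mem [Fintype G] [N.Normal] (ψ : N → ℂ) :
    inducedFunction N ψ ∈ classFunctionsOn N := by
  refine ⟨fun x g => ?_, fun g hg => ?_⟩
  · rw [inducedFunction_apply, inducedFunction_apply]
    congr 1
    exact Fintype.sum_equiv (Equiv.mulRight x) _ _ fun y => by simp [mul_assoc]
  · rw [inducedFunction_apply, Finset.sum_eq_zero, mul_zero]
    intro x _
    refine extendZero_of_notMem N _ ?_
    rwa [Subgroup.Normal.mem_comm_iff ‹_›, inv_mul_cancel_left]

/-- By Frobenius reciprocity both sides pair equally with every irreducible character of `G`, so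
their difference, a class function, vanishes by completeness. The inverses match the pairing that
computes `Hom`. -/
lemma ind_character [Fintype G] {U : Type*} [AddCommGroup U] [Module ℂ U]
    [FiniteDimensional ℂ U] (φ : Representation ℂ N U) :
    (Representation.ind N.subtype φ).character = inducedFunction N φ.character := by
  have : Fintype N := Fintype.ofFinite N
  suffices h : (fun g => (Representation.ind N.subtype φ).character g⁻¹ -
      inducedFunction N φ.character g⁻¹) = 0 by
    ext g
    simpa [sub_eq_zero] using congrFun h g⁻¹
  refine eq_zero_of_forall_sum_mul_character (fun x g => ?_) fun d σ hσ => ?_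
  · have h1 : (x * g * x⁻¹)⁻¹ = x * g⁻¹ * x⁻¹ := by group
    rw [h1, char_conj, inducedFunction_apply, inducedFunction_apply]
    congr 2
    exact Fintype.sum_equiv (Equiv.mulRight x) _ _ fun y => by simp [mul_assoc]
  · have h1 := finrank_intertwiningMap_eq (Representation.ind N.subtype φ) σ
    rw [(indHomEquiv N φ σ).finrank_eq, finrank_intertwiningMap_eq,
      eq_inv_mul_iff_mul_eq₀ card_ne_zero] at h1
    simp only [sub_mul, Finset.sum_sub_distrib]
    rw [← h1, sub_eq_zero]
    simp only [inducedFunction_apply, mul_assoc, Finset.sum_mul]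
    rw [← Finset.mul_sum, Finset.sum_comm]
    -- The inner sum does not depend on `x`, so summing over `x` only contributes the factor `|G|`.
    have h2 : ∀ x : G, ∑ g, extendZero N φ.character (x * (g⁻¹ * x⁻¹)) * σ.character g =
        ∑ n : N, φ.character n⁻¹ * (res N σ).character n := by
      intro x
      calc _ = ∑ g, extendZero N φ.character g * σ.character g⁻¹ := by
            refine Fintype.sum_equiv ((MulAut.conj x).toEquiv.trans (Equiv.inv G)) _ _ fun g => ?_
            simp [MulAut.conj_apply, mul_assoc]
            left
            simpa [mul_assoc] using (σ.char_conj g x).symm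
        _ = ∑ n : N, φ.character n * σ.character (n : G)⁻¹ := sum_extendZero_mul N _ _
        _ = _ := Fintype.sum_equiv (Equiv.inv N) _ _ fun n => by simp [character]
    simp only [h2, Finset.sum_const, Finset.card_univ, nsmul_eq_mul, Nat.card_eq_fintype_card]
    ring

lemma span_extendZero_res_character [Finite G] [N.Normal] {I : Type*} {W : I → Type*}
    [∀ i, AddCommGroup (W i)] [∀ i, Module ℂ (W i)] {ρ : ∀ i, Representation ℂ G (W i)}
    (hρ : IsRestrictionBasis N ρ) :
    Submodule.span ℂ (Set.range fun i => extendZero N (res N (ρ i)).character) =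
      classFunctionsOn N := by
  have : Fintype G := Fintype.ofFinite G
  apply le_antisymm
  · rw [Submodule.span_le]
    rintro _ ⟨i, rfl⟩
    exact extendZero_res_character_mem N (ρ i)
  · intro f hf
    -- Restriction to `N` followed by extension by zero fixes `f` and sends irreducible characters
    -- of `G` into the desired span.
    let R : (G → ℂ) →ₗ[ℂ] (G → ℂ) := extendZero N ∘ₗ LinearMap.funLeft ℂ ℂ (Subtype.val : N → G)
    have hR : R f = f := extendZero_restrict N hf.2
    rw [← hR]
    have hmem := Submodule.mem_map_of_mem (f := R) (class_mem_span_irreducible_characters hf.1)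
    rw [Submodule.map_span] at hmem
    refine Submodule.span_le.2 ?_ hmem
    rintro _ ⟨_, ⟨d, σ, hσ, rfl⟩, rfl⟩
    have := Submodule.mem_map_of_mem (f := extendZero N) (hρ.spanning d σ hσ)
    rw [Submodule.map_span, ← Set.range_comp] at this
    exact this

lemma span_ind_character [Finite G] [N.Normal] {I : Type*} {W : I → Type*}
    [∀ i, AddCommGroup (W i)] [∀ i, Module ℂ (W i)] {φ : ∀ i, Representation ℂ N (W i)}
    (hφ : IsInductionBasis N φ) :
    Submodule.span ℂ (Set.range fun i => (Representation.ind N.subtype (φ i)).character) =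
      classFunctionsOn N := by
  have : Fintype G := Fintype.ofFinite G
  have : Fintype N := Fintype.ofFinite N
  apply le_antisymm
  · rw [Submodule.span_le]
    rintro _ ⟨i, rfl⟩
    have := finiteDimensional_of_isIrreducible (φ i) (hφ.irreducible i)
    rw [SetLike.mem_coe]
    beta_reduce
    rw [ind_character]
    exact inducedFunction_mem N _
  · intro f hf
    -- Inducing the restriction of `f` multiplies it by the index of `N`, so `f` is itself induced
    -- from a class function on `N`.
    have hind : inducedFunction N (fun n => f n) =
        ((Nat.card N : ℂ)⁻¹ * Nat.card G) • f := by
      ext g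
      rw [inducedFunction_apply, extendZero_restrict N hf.2]
      simp only [hf.1]
      simp [mul_assoc]
    have hc : (Nat.card N : ℂ)⁻¹ * Nat.card G ≠ 0 :=
      mul_ne_zero (inv_ne_zero card_ne_zero) card_ne_zero
    rw [← Submodule.smul_mem_iff _ hc, ← hind]
    have hmem := Submodule.mem_map_of_mem (f := inducedFunction N)
      (class_mem_span_irreducible_characters (f := fun n : N => f n) fun x g => hf.1 x g)
    rw [Submodule.map_span] at hmem
    refine Submodule.span_le.2 ?_ hmem
    rintro _ ⟨_, ⟨d, σ, hσ, rfl⟩, rfl⟩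
    rw [← ind_character]
    exact hφ.spanning d σ hσ

end ClassFunctions

/-! ### Determinant and recursion for one adjacency matrix -/

section Core

variable {G : Type*} [Group G] (N : Subgroup G) {I : Type*} [Fintype I]

lemma existsUnique_matrix {E : Type*} [AddCommGroup E] [Module ℂ E] {v w : I → E}
    (hv : LinearIndependent ℂ v) (hw : ∀ j, w j ∈ Submodule.span ℂ (Set.range v)) :
    ∃! A : Matrix I I ℂ, ∀ j, w j = ∑ i, A i j • v i := by
  choose c hc using fun j => Submodule.mem_span_range_iff_exists_fun ℂ |>.1 (hw j)
  refine ⟨Matrix.of fun i j => c j i, fun j => (hc j).symm, fun A hA => ?_⟩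
  ext i j
  have h := (hA j).symm.trans (hc j).symm
  exact hv.eq_coords_of_eq h i

variable [DecidableEq I]

/-- Since `N` is normal, evaluation at the representatives lying in `N` identifies the class
functions supported in `N` with all functions on `Υ ∩ N`, where multiplication by `χ` is diagonal.
-/
lemma detOneSub_eq_charProd [N.Normal] {Υ : Finset G} (hΥ : IsConjRepresentatives Υ)
    {v : I → G → ℂ} (hv : LinearIndependent ℂ v)
    (hspan : Submodule.span ℂ (Set.range v) = classFunctionsOn N) (χ : G → ℂ)
    (A : Matrix I I ℂ) (hA : ∀ j, ∀ g ∈ N, χ g * v j g = ∑ i, A i j * v i g) :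
    detOneSub A = charProd N Υ χ := by
  classical
  let X := {g // g ∈ Υ.filter fun g => g ∈ N}
  let r : (G → ℂ) →ₗ[ℂ] (X → ℂ) := LinearMap.funLeft ℂ ℂ Subtype.val
  choose rep hrep using fun g => (hΥ (ConjClasses.mk g)).exists
  have hrepN : ∀ g, rep g ∈ N ↔ g ∈ N := fun g => by
    obtain ⟨c, hc⟩ := isConj_iff.1 (ConjClasses.mk_eq_mk_iff_isConj.1 (hrep g).2)
    conv_rhs => rw [← hc, Subgroup.Normal.mem_comm_iff ‹_›, inv_mul_cancel_left]
  have hinj : Disjoint (Submodule.span ℂ (Set.range v)) (LinearMap.ker r) := by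
    rw [hspan, Submodule.disjoint_def]
    intro f hf hr
    ext g
    by_cases hg : g ∈ N
    · obtain ⟨c, hc⟩ := isConj_iff.1 (ConjClasses.mk_eq_mk_iff_isConj.1 (hrep g).2)
      rw [← hc, hf.1]
      exact congrFun hr ⟨rep g, Finset.mem_filter.2 ⟨(hrep g).1, (hrepN g).2 hg⟩⟩
    · exact hf.2 g hg
  have hsurj : Submodule.span ℂ (Set.range (r ∘ v)) = ⊤ := by
    rw [Set.range_comp, ← Submodule.map_span, hspan, eq_top_iff]
    intro h _
    refine ⟨fun g => if hg : g ∈ N then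
      h ⟨rep g, Finset.mem_filter.2 ⟨(hrep g).1, (hrepN g).2 hg⟩⟩ else 0, ⟨fun x g => ?_,
        fun g hg => dif_neg hg⟩, ?_⟩
    · have h1 : rep (x * g * x⁻¹) = rep g := by
        refine (hΥ (ConjClasses.mk g)).unique ⟨(hrep _).1, (hrep _).2.trans ?_⟩ (hrep g)
        exact (ConjClasses.mk_eq_mk_iff_isConj.2 (isConj_iff.2 ⟨x, rfl⟩)).symm
      have h2 : x * g * x⁻¹ ∈ N ↔ g ∈ N := by
        rw [← hrepN, h1, hrepN]
      simp only [h1, h2]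
    · ext y
      have hy := Finset.mem_filter.1 y.2
      have h1 : rep y.1 = y.1 := (hΥ (ConjClasses.mk y.1)).unique (hrep _) ⟨hy.1, rfl⟩
      change dite _ _ _ = _
      rw [dif_pos hy.2]
      exact congrArg h (Subtype.ext h1)
  rw [detOneSub_eq_prod (r ∘ v) (hv.map hinj) hsurj (fun x => χ x) A
    fun j x => hA j x (Finset.mem_filter.1 x.2).2]
  unfold charProd
  exact (Finset.prod_coe_sort _ fun g => (1 - PowerSeries.C (χ g) * PowerSeries.X : ℂ⟦X⟧)).trans
    (Finset.prod_congr (by congr!) fun _ _ => rfl)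

/-- Hypothesis `h0` gives the constant terms of the series, and `hV` moves one factor `V` across
`Hom` to give the recursion for Cramer's rule. The `S i` need not be irreducible. -/
lemma poincareSeries_mul_detOneSub {H : Type*} [Group H] [Fintype H] {U : Type*}
    [AddCommGroup U] [Module ℂ U] [FiniteDimensional ℂ U] (V : Representation ℂ H U)
    (hV : ∀ g, V.character g⁻¹ = V.character g) {W : I → Type*} [∀ i, AddCommGroup (W i)]
    [∀ i, Module ℂ (W i)] [∀ i, FiniteDimensional ℂ (W i)] (S : ∀ i, Representation ℂ H (W i))
    (A : Matrix I I ℂ) (hA : IsFusionMatrix V S A) (i₀ : I)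
    (h0 : ∀ j, (Nat.card H : ℂ)⁻¹ * ∑ g, (S j).character g⁻¹ = if j = i₀ then 1 else 0) :
    poincareSeries (S i₀) V * detOneSub A = detOneSub (deleteNode A i₀) := by
  refine mul_detOneSub_eq A (fun j => poincareSeries (S j) V) i₀ fun j => ?_
  ext k
  have hcoeff : ∀ i k, PowerSeries.coeff k (poincareSeries (S i) V) =
      (Nat.card H : ℂ)⁻¹ * ∑ g, (S i).character g⁻¹ * V.character g ^ k := fun i k => by
    rw [poincareSeries, PowerSeries.coeff_mk, finrank_intertwiningMap_eq, tensorPow_character]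
    rfl
  rcases k with _ | k
  · rw [hcoeff]
    simp only [pow_zero, mul_one, h0]
    split_ifs <;> simp
  · rw [map_add, PowerSeries.coeff_succ_X_mul, map_sum, hcoeff]
    have h1 : PowerSeries.coeff (k + 1) (if j = i₀ then (1 : ℂ⟦X⟧) else 0) = 0 := by
      split_ifs <;> simp [PowerSeries.coeff_one]
    simp only [h1, zero_add, PowerSeries.coeff_C_mul, hcoeff]
    have h2 : ∀ g, V.character g * (S j).character g⁻¹ = ∑ i, A i j * (S i).character g⁻¹ := by
      intro g
      have := congrFun (hA j) g⁻¹
      rw [char_tensor, Pi.mul_apply, hV] at this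
      simpa [Finset.sum_apply] using this
    have h3 : ∀ g, (S j).character g⁻¹ * V.character g ^ (k + 1) =
        ∑ i, A i j * ((S i).character g⁻¹ * V.character g ^ k) := by
      intro g
      rw [pow_succ', ← mul_assoc, mul_comm _ (V.character g), h2, Finset.sum_mul]
      simp only [mul_assoc]
    simp only [h3, Finset.mul_sum]
    rw [Finset.sum_comm]
    refine Finset.sum_congr rfl fun i _ => Finset.sum_congr rfl fun g _ => by ring

/-- The inverse of a `2 × 2` matrix of determinant one is its adjugate, which has the same trace. -/
lemma stdRep_character_inv (G : Subgroup SU2) (g : G) :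
    (stdRep G).character g⁻¹ = (stdRep G).character g := by
  have h : ∀ g : G, (stdRep G).character g = ((g : SU2) : Matrix (Fin 2) (Fin 2) ℂ).trace :=
    fun g => Matrix.trace_toLin'_eq _
  rw [h, h]
  have hdet := (Matrix.mem_specialUnitaryGroup_iff.1 (g : SU2).2).2
  have hmul : (((g⁻¹ : G) : SU2) : Matrix (Fin 2) (Fin 2) ℂ) *
      ((g : SU2) : Matrix (Fin 2) (Fin 2) ℂ) = 1 := by
    have := congrArg (fun x : G => ((x : SU2) : Matrix (Fin 2) (Fin 2) ℂ)) (inv_mul_cancel g)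
    exact this
  have hadj : (((g⁻¹ : G) : SU2) : Matrix (Fin 2) (Fin 2) ℂ) =
      ((g : SU2) : Matrix (Fin 2) (Fin 2) ℂ).adjugate := by
    have h1 := Matrix.mul_adjugate ((g : SU2) : Matrix (Fin 2) (Fin 2) ℂ)
    rw [hdet, one_smul] at h1
    calc _ = _ * (_ * _) := by rw [h1, mul_one]
      _ = _ := by rw [← mul_assoc, hmul, one_mul]
  rw [hadj, Matrix.adjugate_fin_two, Matrix.trace_fin_two, Matrix.trace_fin_two]
  simp [add_comm]

end Core

/-! ### Multiplicity of the trivial module in each basis -/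

section Pairs

variable {G : Type*} [Group G] (N : Subgroup G) {I : Type*} [DecidableEq I] {W : I → Type*} [∀ i, AddCommGroup (W i)]
  [∀ i, Module ℂ (W i)]

lemma character_of_isTrivial {H : Type*} [Group H] {U : Type*} [AddCommGroup U] [Module ℂ U]
    [FiniteDimensional ℂ U] (σ : Representation ℂ H U) (h : σ.IsTrivial) :
    σ.character = fun _ => (Module.finrank ℂ U : ℂ) := by
  ext g
  rw [character, σ.isTrivial_def g, LinearMap.trace_id]

/-- By normality the `N`-invariants of `ρ j` are `G`-stable, hence zero or everything. In the latter
case the restricted character is a multiple of the trivial one, and linear independence forces `j =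
i₀`. -/
lemma restriction_multiplicity [Finite G] [N.Normal] [Fintype N] {ρ : ∀ i, Representation ℂ G (W i)}
    (hρ : IsRestrictionBasis N ρ) {i₀ : I} (hi₀ : IsTrivialLine (res N (ρ i₀))) (j : I) :
    (Nat.card N : ℂ)⁻¹ * ∑ g, (res N (ρ j)).character g⁻¹ = if j = i₀ then 1 else 0 := by
  have := finiteDimensional_of_isIrreducible (ρ j) (hρ.irreducible j)
  rw [← finrank_invariants_eq]
  obtain ⟨hU, hp⟩ := (isIrreducible_iff _).1 (hρ.irreducible j)
  split_ifs with hj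
  · subst hj
    have := hi₀.1
    rw [invariants_eq_top, finrank_top, hi₀.2, Nat.cast_one]
  · rcases hp (res N (ρ j)).invariants (fun g v hv => le_comap_invariants (ρ j) N g hv) with h | h
    · rw [h, finrank_bot, Nat.cast_zero]
    · exfalso
      have htriv : (res N (ρ j)).IsTrivial :=
        ⟨fun n => LinearMap.ext fun v => (mem_invariants _ v).1 (h ▸ Submodule.mem_top) n⟩
      have := finiteDimensional_of_isIrreducible (ρ i₀) (hρ.irreducible i₀)
      refine hj (hρ.linearIndependent.eq_of_smul_apply_eq_smul_apply 1
        (Module.finrank ℂ (W j) : ℂ) j i₀ one_ne_zero ?_)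
      ext n
      simp [character_of_isTrivial _ htriv, character_of_isTrivial _ hi₀.1, hi₀.2]

lemma induction_multiplicity [Fintype G] {φ : ∀ i, Representation ℂ N (W i)}
    (hφ : IsInductionBasis N φ) {i₀ : I} (hi₀ : IsTrivialLine (φ i₀)) (j : I) :
    (Nat.card G : ℂ)⁻¹ * ∑ g, (Representation.ind N.subtype (φ j)).character g⁻¹ =
      if j = i₀ then 1 else 0 := by
  have : Fintype N := Fintype.ofFinite N
  have := finiteDimensional_of_isIrreducible (φ j) (hφ.irreducible j)
  have := finiteDimensional_of_isIrreducible (φ i₀) (hφ.irreducible i₀)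
  have hG := finrank_intertwiningMap_eq (Representation.ind N.subtype (φ j))
    (Representation.trivial ℂ G ℂ)
  have htr : ∀ g, (Representation.trivial ℂ G ℂ).character g = 1 := fun g => by
    rw [character_of_isTrivial _ inferInstance]; simp
  simp only [htr, mul_one] at hG
  rw [← hG, (indHomEquiv N _ _).finrank_eq, finrank_intertwiningMap_eq]
  have := hφ.irreducible j
  have := hφ.irreducible i₀
  have : Invertible (Nat.card N : ℂ) := invertibleOfNonzero card_ne_zero
  have hN := char_orthonormal (φ i₀) (φ j)
  rw [character_of_isTrivial _ hi₀.1, hi₀.2] at hN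
  simp only [Nat.cast_one, one_mul] at hN
  have htrN : ∀ n, (res N (Representation.trivial ℂ G ℂ)).character n = 1 := fun n => htr n
  simp only [htrN, mul_one]
  rw [hN]
  congr 1
  -- Isomorphic members have equal induced characters, so independence of these makes the indices
  -- equal.
  refine propext ⟨fun ⟨e⟩ => hφ.linearIndependent.injective ?_, fun h => h ▸ ⟨.refl _⟩⟩
  rw [ind_character, ind_character, char_iso e]

end Pairs

end McKaySlodowy

theorem mainTheorem5
    (G : Subgroup McKaySlodowy.SU2) [Finite G] (N : Subgroup G) [N.Normal]
    {I J : Type*} [Fintype I] [DecidableEq I] [Fintype J] [DecidableEq J]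
    {W : I → Type*} [∀ i, AddCommGroup (W i)] [∀ i, Module ℂ (W i)]
    {Z : J → Type*} [∀ j, AddCommGroup (Z j)] [∀ j, Module ℂ (Z j)]
    (ρ : ∀ i, Representation ℂ G (W i)) (hρ : McKaySlodowy.IsRestrictionBasis N ρ)
    (i₀ : I) (hi₀ : McKaySlodowy.IsTrivialLine (McKaySlodowy.res N (ρ i₀)))
    (φ : ∀ j, Representation ℂ N (Z j)) (hφ : McKaySlodowy.IsInductionBasis N φ)
    (j₀ : J) (hj₀ : McKaySlodowy.IsTrivialLine (φ j₀))
    (Υ : Finset G) (hΥ : McKaySlodowy.IsConjRepresentatives Υ) :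
    -- the adjacency matrices exist and are determined by the chosen bases
    (∃! A : Matrix I I ℂ, McKaySlodowy.IsFusionMatrix
      (McKaySlodowy.res N (McKaySlodowy.stdRep G)) (fun i => McKaySlodowy.res N (ρ i)) A) ∧
    (∃! B : Matrix J J ℂ, McKaySlodowy.IsFusionMatrix
      (McKaySlodowy.stdRep G) (fun j => Representation.ind N.subtype (φ j)) B) ∧
    ∀ (A : Matrix I I ℂ) (B : Matrix J J ℂ),
      McKaySlodowy.IsFusionMatrix (McKaySlodowy.res N (McKaySlodowy.stdRep G))
        (fun i => McKaySlodowy.res N (ρ i)) A →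
      McKaySlodowy.IsFusionMatrix (McKaySlodowy.stdRep G)
        (fun j => Representation.ind N.subtype (φ j)) B →
      McKaySlodowy.poincareSeries (McKaySlodowy.res N (ρ i₀))
          (McKaySlodowy.res N (McKaySlodowy.stdRep G)) =
        McKaySlodowy.invariantSeries (McKaySlodowy.res N (McKaySlodowy.stdRep G)) ∧
      McKaySlodowy.poincareSeries (McKaySlodowy.res N (ρ i₀))
          (McKaySlodowy.res N (McKaySlodowy.stdRep G)) =
        McKaySlodowy.poincareSeries (Representation.ind N.subtype (φ j₀))
          (McKaySlodowy.stdRep G) ∧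
      McKaySlodowy.poincareSeries (Representation.ind N.subtype (φ j₀))
          (McKaySlodowy.stdRep G) =
        McKaySlodowy.detOneSub (McKaySlodowy.deleteNode A i₀) *
          (McKaySlodowy.detOneSub A)⁻¹ ∧
      McKaySlodowy.detOneSub (McKaySlodowy.deleteNode A i₀) *
          (McKaySlodowy.detOneSub A)⁻¹ =
        McKaySlodowy.detOneSub (McKaySlodowy.deleteNode B j₀) *
          (McKaySlodowy.detOneSub B)⁻¹ ∧
      McKaySlodowy.detOneSub (McKaySlodowy.deleteNode B j₀) *
          (McKaySlodowy.detOneSub B)⁻¹ =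
        McKaySlodowy.detOneSub (McKaySlodowy.deleteNode A i₀) *
          (McKaySlodowy.charProd N Υ (McKaySlodowy.stdRep G).character)⁻¹ ∧
      McKaySlodowy.detOneSub (McKaySlodowy.deleteNode A i₀) *
          (McKaySlodowy.charProd N Υ (McKaySlodowy.stdRep G).character)⁻¹ =
        McKaySlodowy.detOneSub (McKaySlodowy.deleteNode B j₀) *
          (McKaySlodowy.charProd N Υ (McKaySlodowy.stdRep G).character)⁻¹ := by
  classical
  have : Fintype G := Fintype.ofFinite G
  have : Fintype N := Fintype.ofFinite N
  have hfinρ : ∀ i, FiniteDimensional ℂ (W i) := fun i =>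
    McKaySlodowy.finiteDimensional_of_isIrreducible (ρ i) (hρ.irreducible i)
  have hfinφ : ∀ j, FiniteDimensional ℂ (Z j) := fun j =>
    McKaySlodowy.finiteDimensional_of_isIrreducible (φ j) (hφ.irreducible j)
  set V := McKaySlodowy.stdRep G with hVdef
  have hV : ∀ g, V.character g⁻¹ = V.character g := McKaySlodowy.stdRep_character_inv G
  have hspanρ := McKaySlodowy.span_extendZero_res_character N hρ
  have hspanφ := McKaySlodowy.span_ind_character N hφ
  have hliρ : LinearIndependent ℂ fun i =>
      McKaySlodowy.extendZero N (McKaySlodowy.res N (ρ i)).character :=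
    hρ.linearIndependent.map' _ (LinearMap.ker_eq_bot.2 (McKaySlodowy.extendZero_injective N))
  refine ⟨?_, ?_, fun A B hA hB => ?_⟩
  · refine McKaySlodowy.existsUnique_matrix hρ.linearIndependent fun j => ?_
    -- `V ⊗ ρ j` restricts to the product of the restrictions; membership in the span is read off
    -- after extension by zero, which is injective.
    have h := McKaySlodowy.extendZero_res_character_mem N (V.tprod (ρ j))
    rw [← hspanρ, Set.range_comp' (McKaySlodowy.extendZero N), ← Submodule.map_span] at h
    obtain ⟨ψ, hψ, he⟩ := h
    exact McKaySlodowy.extendZero_injective N he ▸ hψ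
  · refine McKaySlodowy.existsUnique_matrix hφ.linearIndependent fun j => ?_
    have h : (Representation.ind N.subtype (φ j)).character ∈
        McKaySlodowy.classFunctionsOn N := by
      rw [← hspanφ]
      exact Submodule.subset_span ⟨j, rfl⟩
    rw [hspanφ]
    refine ⟨fun x g => Representation.char_conj _ g x, fun g hg => ?_⟩
    rw [Representation.char_tensor, Pi.mul_apply, h.2 g hg, mul_zero]
  · have hprodA : McKaySlodowy.detOneSub A = McKaySlodowy.charProd N Υ V.character := by
      refine McKaySlodowy.detOneSub_eq_charProd N hΥ hliρ hspanρ _ A fun j g hg => ?_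
      have h := congrFun (hA j) ⟨g, hg⟩
      rw [Representation.char_tensor] at h
      have hx := fun i => McKaySlodowy.extendZero_coe N
        (McKaySlodowy.res N (ρ i)).character ⟨g, hg⟩
      simp only [hx]
      simpa [Finset.sum_apply] using! h
    have hprodB : McKaySlodowy.detOneSub B = McKaySlodowy.charProd N Υ V.character := by
      refine McKaySlodowy.detOneSub_eq_charProd N hΥ hφ.linearIndependent hspanφ _ B
        fun j g _ => ?_
      have h := congrFun (hB j) g
      rw [Representation.char_tensor] at h
      simpa [Finset.sum_apply] using h
    have hcramerA := McKaySlodowy.poincareSeries_mul_detOneSub (McKaySlodowy.res N V)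
      (fun n => hV n) (fun i => McKaySlodowy.res N (ρ i)) A hA i₀
      (McKaySlodowy.restriction_multiplicity N hρ hi₀)
    have hcramerB := McKaySlodowy.poincareSeries_mul_detOneSub V hV
      (fun j => Representation.ind N.subtype (φ j)) B hB j₀
      (McKaySlodowy.induction_multiplicity N hφ hj₀)
    have hinv : McKaySlodowy.poincareSeries (McKaySlodowy.res N (ρ i₀)) (McKaySlodowy.res N V) =
        McKaySlodowy.invariantSeries (McKaySlodowy.res N V) := by
      ext k
      rw [McKaySlodowy.poincareSeries, McKaySlodowy.invariantSeries, PowerSeries.coeff_mk,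
        PowerSeries.coeff_mk, McKaySlodowy.finrank_intertwiningMap_eq,
        McKaySlodowy.finrank_invariants_eq, McKaySlodowy.character_of_isTrivial _ hi₀.1, hi₀.2]
      congr 1
      exact Fintype.sum_equiv (Equiv.inv N) _ _ fun n => by simp
    have hfrob : McKaySlodowy.poincareSeries (McKaySlodowy.res N (ρ i₀))
        (McKaySlodowy.res N V) =
        McKaySlodowy.poincareSeries (Representation.ind N.subtype (φ j₀)) V := by
      ext k
      rw [McKaySlodowy.poincareSeries, McKaySlodowy.poincareSeries, PowerSeries.coeff_mk,
        PowerSeries.coeff_mk, (McKaySlodowy.indHomEquiv N _ _).finrank_eq,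
        McKaySlodowy.finrank_intertwiningMap_eq, McKaySlodowy.finrank_intertwiningMap_eq,
        McKaySlodowy.character_of_isTrivial _ hi₀.1, hi₀.2,
        McKaySlodowy.character_of_isTrivial _ hj₀.1, hj₀.2]
      rfl
    rw [hfrob] at hcramerA
    -- A power series with zero constant term has inverse `0` by convention, so this makes the
    -- quotients genuine.
    have hne : PowerSeries.constantCoeff (McKaySlodowy.detOneSub A) ≠ 0 := by
      rw [McKaySlodowy.constantCoeff_detOneSub]
      exact one_ne_zero
    -- Each numerator is the common series times the common denominator.
    have hAB : McKaySlodowy.detOneSub (McKaySlodowy.deleteNode A i₀) =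
        McKaySlodowy.detOneSub (McKaySlodowy.deleteNode B j₀) := by
      rw [← hcramerA, ← hcramerB, hprodA, hprodB]
    refine ⟨hinv, hfrob, ?_, ?_, ?_, ?_⟩
    · rw [← hcramerA, mul_assoc, PowerSeries.mul_inv_cancel _ hne, mul_one]
    · rw [hAB, hprodA, hprodB]
    · rw [hAB, hprodB]
    · rw [hAB]
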